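/- Let $\mathfrak N$ be a finite-dimensional real 2-step nilpotent Lie algebra (that is, $[[X,Y],W]=0$ for all $X,Y,W\in\mathfrak N$, and $\mathfrak N$ is not abelian) with an inner product $\langle\,,\rangle$. Let $N$ be the simply connected Lie group with Lie algebra $\mathfrak N$, equipped with the left-invariant Riemannian metric that equals $\langle\,,\rangle$ on $\mathfrak N=T_eN$. Let $\mathfrak Z$ be the center of $\mathfrak N$ and $\mathfrak V=\mathfrak Z^{\perp}$, and for $Z\in\mathfrak Z$ let $j(Z):\mathfrak V\to\mathfrak V$ be the skew-symmetric linear map defined by $\langle j(Z)X,Y\rangle=\langle [X,Y],Z\rangle$ for all $X,Y\in\mathfrak V$. Let $Z\in[\mathfrak N,\mathfrak N]$ with $Z\neq 0$, and let $\gamma_Z$ be the geodesic $\gamma_Z(s)=\exp(sZ)$ of $N$. For $t>0$ let $J_t$ denote the real vector space of Jacobi fields $Y$ along $\gamma_Z$ with $Y(0)=0$ and $Y(t)=0$. Call $t>0$ a conjugate value of $\gamma_Z$ if $J_t\neq\{0\}$, and then call $m(t)=\dim_{\mathbb R} J_t$ its multiplicity. Let $$c(Z,t)=\Big\{\mu\in\tfrac{2\pi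 i}{t}\,\mathbb Z^{+} : \mu \text{ is a (complex) eigenvalue of } j(Z)\Big\},$$ where $\mathbb Z^{+}=\{1,2,3,\dots\}$, and for $\mu\in c(Z,t)$ let $m(\mu)$ be the multiplicity of $\mu$ as an eigenvalue of $j(Z)$. Then for every $t>0$: 1. $t$ is a conjugate value of $\gamma_Z$ if and only if $c(Z,t)$ is nonempty. 2. If $t$ is a conjugate value of $\gamma_Z$, then its multiplicity is $m(t)=2\sum_{\mu\in c(Z,t)}m(\mu)$ (a finite sum). In particular $m(t)$ is even. -/

import Mathlib

open scoped ContDiff Manifold TensorProduct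

set_option maxSynthPendingDepth 3

/-! ### Riemannian geometry in a global chart

The manifold is a finite dimensional real vector space `E` (one global chart), every tangent space
is identified with `E`, and a vector field along a curve is a function `ℝ → E`. -/

section Riemannian

/-- A smooth Riemannian metric on the vector space `E`: a smoothly varying inner product
`val x` on each tangent space `T_x E = E`. -/
structure CoordMetric (E : Type*) [NormedAddCommGroup E] [NormedSpace ℝ E] where
  val : E → E →L[ℝ] E →L[ℝ] ℝ
  smooth : ContDiff ℝ ∞ val
  symm : ∀ x u v, val x u v = val x v u
  pos : ∀ x u, u ≠ 0 → 0 < val x u u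

namespace CoordMetric

variable {E : Type*} [NormedAddCommGroup E] [NormedSpace ℝ E] (g : CoordMetric E)

/-- The Christoffel symbols of the first kind, as a covector:
`w ↦ ½ (∂_u g(v,w) + ∂_v g(u,w) - ∂_w g(u,v))` at the point `x`. -/
noncomputable def koszul (x u v : E) : E →L[ℝ] ℝ :=
  (1 / 2 : ℝ) • (fderiv ℝ g.val x u v + fderiv ℝ g.val x v u
    - ((fderiv ℝ g.val x).flip u).flip v)

theorem koszul_apply (x u v w : E) :
    g.koszul x u v w = 1 / 2 * (fderiv ℝ g.val x u v w + fderiv ℝ g.val x v u w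
      - fderiv ℝ g.val x w u v) := by
  simp [koszul]

/-- The Christoffel symbols (of the second kind) `Γ_x(u,v)` of the Levi-Civita connection, obtained
from `koszul` by raising the index with the inverse of the metric; so
`(∇_U V)(x) = DV_x(U x) + Γ_x(U x, V x)`. See `val_christoffel` for the characterisation. -/
noncomputable def christoffel (x u v : E) : E :=
  (g.val x).inverse (g.koszul x u v)

theorem christoffel_add_left (x u u' v : E) :
    g.christoffel x (u + u') v = g.christoffel x u v + g.christoffel x u' v := by
  unfold christoffel
  rw [← map_add]
  congr 1
  ext w
  simp only [koszul_apply, map_add, add_apply]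
  ring

theorem christoffel_smul_left (x : E) (c : ℝ) (u v : E) :
    g.christoffel x (c • u) v = c • g.christoffel x u v := by
  unfold christoffel
  rw [← map_smul]
  congr 1
  ext w
  simp only [koszul_apply, map_smul, smul_apply, smul_eq_mul]
  ring

theorem christoffel_add_right (x u v v' : E) :
    g.christoffel x u (v + v') = g.christoffel x u v + g.christoffel x u v' := by
  unfold christoffel
  rw [← map_add]
  congr 1
  ext w
  simp only [koszul_apply, map_add, add_apply]
  ring

theorem christoffel_smul_right (x : E) (c : ℝ) (u v : E) :
    g.christoffel x u (c • v) = c • g.christoffel x u v := by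
  unfold christoffel
  rw [← map_smul]
  congr 1
  ext w
  simp only [koszul_apply, map_smul, smul_apply, smul_eq_mul]
  ring

/-- The Riemann curvature tensor `R(u,v)w = ∇_u ∇_v w - ∇_v ∇_u w - ∇_{[u,v]} w` at the point `x`,
written out with the Christoffel symbols. -/
noncomputable def curvature (x u v w : E) : E :=
  fderiv ℝ (fun y => g.christoffel y v w) x u - fderiv ℝ (fun y => g.christoffel y u w) x v
    + g.christoffel x u (g.christoffel x v w) - g.christoffel x v (g.christoffel x u w)

/-- `K` is the covariant derivative `D J / dt = J' + Γ_γ(γ', J)` at time `t` of the vector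
field `J` along the curve `γ`. -/
def HasCovDerivAt (γ : ℝ → E) (J : ℝ → E) (K : E) (t : ℝ) : Prop :=
  HasDerivAt J (K - g.christoffel (γ t) (deriv γ t) (J t)) t

/-- `J` is a Jacobi field along `γ`: it has a covariant derivative `J'`, which again has a
covariant derivative `J''`, and `J'' + R(J, γ') γ' = 0`. -/
def IsJacobiField (γ : ℝ → E) (J : ℝ → E) : Prop :=
  ∃ J₁ J₂ : ℝ → E, (∀ t, g.HasCovDerivAt γ J (J₁ t) t) ∧ (∀ t, g.HasCovDerivAt γ J₁ (J₂ t) t) ∧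
    ∀ t, J₂ t + g.curvature (γ t) (J t) (deriv γ t) (deriv γ t) = 0

variable [FiniteDimensional ℝ E]

theorem exists_equiv (x : E) : ∃ e : E ≃L[ℝ] (E →L[ℝ] ℝ), (e : E →L[ℝ] E →L[ℝ] ℝ) = g.val x := by
  have hinj : Function.Injective (g.val x : E →ₗ[ℝ] E →L[ℝ] ℝ) := by
    rw [injective_iff_map_eq_zero]
    intro u hu
    by_contra h
    have h1 := g.pos x u h
    have h2 : g.val x u = 0 := hu
    simp [h2] at h1
  have hdim : Module.finrank ℝ E = Module.finrank ℝ (E →L[ℝ] ℝ) := by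
    rw [← (LinearMap.toContinuousLinearMap : (E →ₗ[ℝ] ℝ) ≃ₗ[ℝ] E →L[ℝ] ℝ).finrank_eq]
    exact (Subspace.dual_finrank_eq).symm
  refine ⟨(LinearEquiv.ofInjectiveOfFinrankEq (g.val x : E →ₗ[ℝ] E →L[ℝ] ℝ) hinj
    hdim).toContinuousLinearEquiv, ?_⟩
  ext u v
  simp [LinearEquiv.ofInjectiveOfFinrankEq]

theorem val_christoffel (x u v w : E) :
    g.val x (g.christoffel x u v) w = 1 / 2 * (fderiv ℝ g.val x u v w + fderiv ℝ g.val x v u w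
      - fderiv ℝ g.val x w u v) := by
  obtain ⟨e, he⟩ := g.exists_equiv x
  rw [← koszul_apply, christoffel, ← he, ContinuousLinearMap.inverse_equiv]
  simp

theorem contDiff_christoffel (u v : E) : ContDiff ℝ ∞ (fun x => g.christoffel x u v) := by
  have h1 : ContDiff ℝ ∞ (fun x => (g.val x).inverse) := by
    rw [contDiff_iff_contDiffAt]
    intro x
    obtain ⟨e, he⟩ := g.exists_equiv x
    have h := contDiffAt_map_inverse (𝕜 := ℝ) (n := ∞) e
    rw [he] at h
    exact h.comp x g.smooth.contDiffAt
  have hD : ContDiff ℝ ∞ (fderiv ℝ g.val) := g.smooth.fderiv_right (by simp)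
  have h2 : ContDiff ℝ ∞ (fun x => g.koszul x u v) := by
    rw [contDiff_clm_apply_iff]
    intro w
    simp only [koszul_apply]
    have a (p q r : E) : ContDiff ℝ ∞ (fun x => fderiv ℝ g.val x p q r) :=
      ((hD.clm_apply contDiff_const).clm_apply contDiff_const).clm_apply contDiff_const
    exact contDiff_const.mul (((a u v w).add (a v u w)).sub (a w u v))
  exact h1.clm_apply h2

theorem curvature_add (x u u' v w : E) :
    g.curvature x (u + u') v w = g.curvature x u v w + g.curvature x u' v w := by
  have hd (a b : E) : DifferentiableAt ℝ (fun y => g.christoffel y a b) x :=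
    (g.contDiff_christoffel a b).differentiable (by simp) x
  simp only [curvature, christoffel_add_left, christoffel_add_right, map_add]
  rw [fderiv_fun_add (hd u w) (hd u' w)]
  simp only [add_apply]
  abel

theorem curvature_smul (x : E) (c : ℝ) (u v w : E) :
    g.curvature x (c • u) v w = c • g.curvature x u v w := by
  have hd (a b : E) : DifferentiableAt ℝ (fun y => g.christoffel y a b) x :=
    (g.contDiff_christoffel a b).differentiable (by simp) x
  simp only [curvature, christoffel_smul_left, christoffel_smul_right, map_smul]
  rw [fderiv_fun_const_smul (hd u w)]
  simp only [smul_apply, smul_sub, smul_add]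

theorem isJacobiField_zero (γ : ℝ → E) : g.IsJacobiField γ 0 := by
  have h0 (x u : E) : g.christoffel x u 0 = 0 := by
    simpa using g.christoffel_smul_right x 0 u 0
  refine ⟨0, 0, fun t => ?_, fun t => ?_, fun t => ?_⟩
  · simp [HasCovDerivAt, h0]
  · simp [HasCovDerivAt, h0]
  · simpa using g.curvature_smul (γ t) 0 0 (deriv γ t) (deriv γ t)

theorem IsJacobiField.add {g : CoordMetric E} {γ J K : ℝ → E} (hJ : g.IsJacobiField γ J)
    (hK : g.IsJacobiField γ K) : g.IsJacobiField γ (J + K) := by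
  obtain ⟨J₁, J₂, h1, h2, h3⟩ := hJ
  obtain ⟨K₁, K₂, k1, k2, k3⟩ := hK
  refine ⟨J₁ + K₁, J₂ + K₂, fun t => ?_, fun t => ?_, fun t => ?_⟩
  · refine ((h1 t).add (k1 t)).congr_deriv ?_
    simp only [Pi.add_apply, christoffel_add_right]
    abel
  · refine ((h2 t).add (k2 t)).congr_deriv ?_
    simp only [Pi.add_apply, christoffel_add_right]
    abel
  · have := congrArg₂ (· + ·) (h3 t) (k3 t)
    simp only [add_zero] at this
    rw [← this]
    simp only [Pi.add_apply, curvature_add]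
    abel

theorem IsJacobiField.smul {g : CoordMetric E} {γ J : ℝ → E} (c : ℝ)
    (hJ : g.IsJacobiField γ J) : g.IsJacobiField γ (c • J) := by
  obtain ⟨J₁, J₂, h1, h2, h3⟩ := hJ
  refine ⟨c • J₁, c • J₂, fun t => ?_, fun t => ?_, fun t => ?_⟩
  · refine ((h1 t).const_smul c).congr_deriv ?_
    simp only [Pi.smul_apply, christoffel_smul_right, smul_sub]
  · refine ((h2 t).const_smul c).congr_deriv ?_
    simp only [Pi.smul_apply, christoffel_smul_right, smul_sub]
  · have := congrArg (c • ·) (h3 t)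
    simpa [curvature_smul] using this

/-- The vector space of Jacobi fields along `γ` that vanish at the times `0` and `t`. -/
def jacobiVanishing (γ : ℝ → E) (t : ℝ) : Submodule ℝ (ℝ → E) where
  carrier := {J | g.IsJacobiField γ J ∧ J 0 = 0 ∧ J t = 0}
  zero_mem' := ⟨g.isJacobiField_zero γ, rfl, rfl⟩
  add_mem' := by
    rintro J K ⟨h1, h2, h3⟩ ⟨k1, k2, k3⟩
    exact ⟨h1.add k1, by simp [h2, k2], by simp [h3, k3]⟩
  smul_mem' := by
    rintro c J ⟨h1, h2, h3⟩
    exact ⟨h1.smul c, by simp [h2], by simp [h3]⟩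

/-- `t > 0` is a conjugate value of the geodesic `γ`: the point `γ t` is conjugate to `γ 0`
along `γ`, that is, some Jacobi field along `γ` that is not identically zero vanishes at the times
`0` and `t`. -/
def IsConjugateValue (γ : ℝ → E) (t : ℝ) : Prop :=
  0 < t ∧ ∃ J : ℝ → E, g.IsJacobiField γ J ∧ J ≠ 0 ∧ J 0 = 0 ∧ J t = 0

/-- The multiplicity of `t` as a conjugate value of `γ`. -/
noncomputable def conjugateMultiplicity (γ : ℝ → E) (t : ℝ) : ℕ :=
  Module.finrank ℝ (g.jacobiVanishing γ t)

end CoordMetric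

end Riemannian

/-! ### Metric 2-step nilpotent Lie algebras -/

/-- A real Lie algebra with an inner product (no compatibility between the two). -/
class MetricLieAlgebra (𝔫 : Type*) extends NormedAddCommGroup 𝔫, LieRing 𝔫,
  InnerProductSpace ℝ 𝔫, LieAlgebra ℝ 𝔫

/-- `[[X,Y],Z] = 0` for all `X, Y, Z`, and the Lie algebra is not abelian. -/
class IsTwoStepNilpotent (𝔫 : Type*) [LieRing 𝔫] : Prop where
  lie_lie_eq_zero : ∀ X Y Z : 𝔫, ⁅⁅X, Y⁆, Z⁆ = 0
  exists_lie_ne_zero : ∃ X Y : 𝔫, ⁅X, Y⁆ ≠ 0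

section LieAlg

variable {𝔫 : Type*} [MetricLieAlgebra 𝔫] [FiniteDimensional ℝ 𝔫]

/-- The bracket as a continuous bilinear map. -/
noncomputable def bracketL (𝔫 : Type*) [MetricLieAlgebra 𝔫] [FiniteDimensional ℝ 𝔫] :
    𝔫 →L[ℝ] 𝔫 →L[ℝ] 𝔫 :=
  LinearMap.toContinuousBilinearMap
    (LinearMap.mk₂ ℝ (fun X Y : 𝔫 => ⁅X, Y⁆) add_lie smul_lie lie_add fun c X Y => lie_smul c X Y)

theorem bracketL_apply (X Y : 𝔫) : bracketL 𝔫 X Y = ⁅X, Y⁆ := by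
  simp [bracketL]

/-- The orthogonal complement `𝔙` of the center of `𝔫`. -/
noncomputable def vSpace (𝔫 : Type*) [MetricLieAlgebra 𝔫] : Submodule ℝ 𝔫 :=
  (LieAlgebra.center ℝ 𝔫).toSubmoduleᗮ

/-- `j(Z) : 𝔙 → 𝔙`, the linear map with `⟨j(Z) X, Y⟩ = ⟨[X,Y], Z⟩`; see `inner_jMap`. -/
noncomputable def jMap (Z : 𝔫) : vSpace 𝔫 →ₗ[ℝ] vSpace 𝔫 where
  toFun X := (InnerProductSpace.toDual ℝ (vSpace 𝔫)).symm
    ((innerSL ℝ Z).comp ((bracketL 𝔫 (X : 𝔫)).comp (vSpace 𝔫).subtypeL))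
  map_add' X X' := by
    rw [← map_add]
    congr 1
    ext Y
    simp
  map_smul' c X := by
    have h : (innerSL ℝ Z).comp ((bracketL 𝔫 ((c • X : vSpace 𝔫) : 𝔫)).comp (vSpace 𝔫).subtypeL)
        = c • (innerSL ℝ Z).comp ((bracketL 𝔫 (X : 𝔫)).comp (vSpace 𝔫).subtypeL) := by
      ext Y
      simp
    rw [h, LinearIsometryEquiv.map_smulₛₗ]
    simp

theorem inner_jMap (Z : 𝔫) (X Y : vSpace 𝔫) :
    inner ℝ (jMap Z X) Y = inner ℝ ⁅(X : 𝔫), (Y : 𝔫)⁆ Z := by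
  rw [real_inner_comm Z]
  simp [jMap, bracketL_apply]

/-- The complex linear extension of `j(Z)` to `ℂ ⊗ 𝔙`. The (complex) eigenvalues of `j(Z)` and
their multiplicities are those of this map. -/
noncomputable def jMapC (Z : 𝔫) : (ℂ ⊗[ℝ] vSpace 𝔫) →ₗ[ℂ] (ℂ ⊗[ℝ] vSpace 𝔫) :=
  (jMap Z).baseChange ℂ

/-- The multiplicity `m(μ)` of `μ` as an eigenvalue of `j(Z)`: the complex dimension of the
eigenspace. (As `j(Z)` is skew symmetric, this is also the algebraic multiplicity.) -/
noncomputable def eigenMultiplicity (Z : 𝔫) (μ : ℂ) : ℕ :=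
  Module.finrank ℂ (Module.End.eigenspace (jMapC Z) μ)

/-- `c(Z,t)`, the set of eigenvalues of `j(Z)` lying in `(2πi/t) ℤ⁺`. -/
def cSet (Z : 𝔫) (t : ℝ) : Set ℂ :=
  {μ | (∃ k : ℕ, 0 < k ∧ μ = 2 * Real.pi * Complex.I / t * k) ∧
    Module.End.HasEigenvalue (jMapC Z) μ}

end LieAlg

/-! ### The simply connected Lie group `N` with Lie algebra `𝔫`

For a 2-step nilpotent Lie algebra the exponential map is a diffeomorphism `𝔫 → N`, and by the
Campbell-Baker-Hausdorff formula `exp X * exp Y = exp (X + Y + ½ [X,Y])`. So `N` is `𝔫` with this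
multiplication, and `exp` is the identity of the underlying vector spaces. -/

/-- The underlying manifold of `N` is the vector space `𝔫`. -/
def NilGroup (𝔫 : Type*) : Type _ := 𝔫

namespace NilGroup

section

variable {𝔫 : Type*}

/-- The Lie group exponential map; see `exp_add_smul` and `lieBracket_invField`. -/
def exp : 𝔫 ≃ NilGroup 𝔫 := Equiv.refl _

/-- The inverse of the exponential map, the global chart of `N`. -/
def log : NilGroup 𝔫 ≃ 𝔫 := exp.symm

@[simp] theorem log_exp (X : 𝔫) : log (exp X) = X := rfl

@[simp] theorem exp_log (a : NilGroup 𝔫) : exp (log a) = a := rfl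

end

variable {𝔫 : Type*} [MetricLieAlgebra 𝔫] [IsTwoStepNilpotent 𝔫]

theorem lie_lie_right (X Y Z : 𝔫) : ⁅X, ⁅Y, Z⁆⁆ = 0 := by
  rw [← lie_skew, IsTwoStepNilpotent.lie_lie_eq_zero, neg_zero]

noncomputable instance : Group (NilGroup 𝔫) where
  mul a b := exp (log a + log b + (1 / 2 : ℝ) • ⁅log a, log b⁆)
  one := exp 0
  inv a := exp (-log a)
  mul_assoc a b c := by
    change exp (_ : 𝔫) = exp _
    congr 1
    change (log a + log b + (1 / 2 : ℝ) • ⁅log a, log b⁆) + log c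
        + (1 / 2 : ℝ) • ⁅log a + log b + (1 / 2 : ℝ) • ⁅log a, log b⁆, log c⁆
      = log a + (log b + log c + (1 / 2 : ℝ) • ⁅log b, log c⁆)
        + (1 / 2 : ℝ) • ⁅log a, log b + log c + (1 / 2 : ℝ) • ⁅log b, log c⁆⁆
    simp only [add_lie, lie_add, smul_lie, lie_smul, IsTwoStepNilpotent.lie_lie_eq_zero,
      lie_lie_right, smul_add, smul_zero, add_zero]
    abel
  one_mul a := by
    change exp ((0 : 𝔫) + log a + (1 / 2 : ℝ) • ⁅(0 : 𝔫), log a⁆) = a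
    simp
  mul_one a := by
    change exp (log a + (0 : 𝔫) + (1 / 2 : ℝ) • ⁅log a, (0 : 𝔫)⁆) = a
    simp
  inv_mul_cancel a := by
    change exp (-log a + log a + (1 / 2 : ℝ) • ⁅-log a, log a⁆) = exp 0
    simp

theorem log_mul (a b : NilGroup 𝔫) :
    log (a * b) = log a + log b + (1 / 2 : ℝ) • ⁅log a, log b⁆ := rfl

theorem log_inv (a : NilGroup 𝔫) : log a⁻¹ = -log a := rfl

theorem exp_zero : exp (0 : 𝔫) = 1 := rfl

/-- `t ↦ exp (t Z)` is a one-parameter subgroup. -/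
theorem exp_add_smul (s t : ℝ) (Z : 𝔫) : exp ((s + t) • Z) = exp (s • Z) * exp (t • Z) := by
  apply log.injective
  rw [log_mul]
  simp [add_smul]

instance : TopologicalSpace (NilGroup 𝔫) := inferInstanceAs (TopologicalSpace 𝔫)

instance : ChartedSpace 𝔫 (NilGroup 𝔫) := inferInstanceAs (ChartedSpace 𝔫 𝔫)

instance : IsManifold 𝓘(ℝ, 𝔫) ∞ (NilGroup 𝔫) := inferInstanceAs (IsManifold 𝓘(ℝ, 𝔫) ∞ 𝔫)

instance : SimplyConnectedSpace (NilGroup 𝔫) := inferInstanceAs (SimplyConnectedSpace 𝔫)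

variable [FiniteDimensional ℝ 𝔫]

instance : LieGroup 𝓘(ℝ, 𝔫) ∞ (NilGroup 𝔫) where
  contMDiff_mul := by
    have h : ContDiff ℝ ∞ (fun p : 𝔫 × 𝔫 => p.1 + p.2 + (1 / 2 : ℝ) • bracketL 𝔫 p.1 p.2) := by
      fun_prop
    have h' := h.contMDiff
    simp only [bracketL_apply] at h'
    rw [modelWithCornersSelf_prod, ← chartedSpaceSelf_prod] at h'
    exact h'
  contMDiff_inv := (contDiff_neg : ContDiff ℝ ∞ (fun x : 𝔫 => -x)).contMDiff

/-- Left translation by `a`, in the global chart. -/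
noncomputable def leftTrans (a : NilGroup 𝔫) (x : 𝔫) : 𝔫 := log (a * exp x)

theorem hasFDerivAt_leftTrans (a : NilGroup 𝔫) (x : 𝔫) :
    HasFDerivAt (leftTrans a)
      (ContinuousLinearMap.id ℝ 𝔫 + (1 / 2 : ℝ) • bracketL 𝔫 (log a)) x := by
  have h : leftTrans a = fun y : 𝔫 => log a + y + (1 / 2 : ℝ) • bracketL 𝔫 (log a) y := by
    funext y
    rw [leftTrans, log_mul, log_exp, bracketL_apply]
  rw [h]
  exact ((hasFDerivAt_id x).const_add _).add
    ((bracketL 𝔫 (log a)).hasFDerivAt.const_smul (1 / 2 : ℝ))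

theorem fderiv_leftTrans_apply (a : NilGroup 𝔫) (x u : 𝔫) :
    fderiv ℝ (leftTrans a) x u = u + (1 / 2 : ℝ) • ⁅log a, u⁆ := by
  rw [(hasFDerivAt_leftTrans a x).fderiv]
  simp [bracketL_apply]

/-- The left invariant vector field on `N` with value `X ∈ 𝔫 = T_e N` at the identity, in the
global chart. -/
noncomputable def invField (X : 𝔫) (x : 𝔫) : 𝔫 := fderiv ℝ (leftTrans (exp x)) 0 X

/-- The Lie algebra of left invariant vector fields on `N` is `𝔫`. -/
theorem lieBracket_invField (X Y : 𝔫) :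
    VectorField.lieBracket ℝ (invField X) (invField Y) = invField ⁅X, Y⁆ := by
  have h (U x : 𝔫) : HasFDerivAt (invField U) ((1 / 2 : ℝ) • (bracketL 𝔫).flip U) x := by
    have e : invField U = fun x : 𝔫 => U + (1 / 2 : ℝ) • (bracketL 𝔫).flip U x := by
      funext x
      simp [invField, fderiv_leftTrans_apply, bracketL_apply]
    rw [e]
    exact (((bracketL 𝔫).flip U).hasFDerivAt.const_smul (1 / 2 : ℝ)).const_add U
  funext x
  rw [VectorField.lieBracket, (h X x).fderiv, (h Y x).fderiv]
  simp only [invField, fderiv_leftTrans_apply, log_exp, smul_apply,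
    ContinuousLinearMap.flip_apply, bracketL_apply, add_lie, smul_lie, lie_lie_right,
    IsTwoStepNilpotent.lie_lie_eq_zero, smul_zero, add_zero]
  rw [← lie_skew X Y]
  module

/-- The left invariant Riemannian metric on `N` that is the given inner product on
`𝔫 = T_e N`: `⟨u, v⟩_x = ⟨dL_{x⁻¹} u, dL_{x⁻¹} v⟩` for `u, v ∈ T_x N`. -/
noncomputable def leftInvMetric (𝔫 : Type*) [MetricLieAlgebra 𝔫] [IsTwoStepNilpotent 𝔫]
    [FiniteDimensional ℝ 𝔫] : CoordMetric 𝔫 where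
  val x := (innerSL ℝ).bilinearComp (fderiv ℝ (leftTrans (exp x)⁻¹) x)
    (fderiv ℝ (leftTrans (exp x)⁻¹) x)
  smooth := by
    rw [contDiff_clm_apply_iff]
    intro u
    rw [contDiff_clm_apply_iff]
    intro v
    simp only [ContinuousLinearMap.bilinearComp_apply, fderiv_leftTrans_apply, log_inv, log_exp,
      innerSL_apply_apply, ← bracketL_apply]
    have h (w : 𝔫) : ContDiff ℝ ∞ (fun x : 𝔫 => w + (1 / 2 : ℝ) • bracketL 𝔫 (-x) w) := by
      fun_prop
    exact (h u).inner ℝ (h v)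
  symm x u v := by
    simp only [ContinuousLinearMap.bilinearComp_apply, innerSL_apply_apply]
    exact real_inner_comm _ _
  pos x u hu := by
    simp only [ContinuousLinearMap.bilinearComp_apply, innerSL_apply_apply]
    refine real_inner_self_pos.2 fun h => hu ?_
    rw [fderiv_leftTrans_apply, log_inv, log_exp] at h
    have h2 : ⁅x, u⁆ = 0 := by
      have := congrArg (fun y => ⁅x, y⁆) h
      simpa [lie_lie_right] using this
    simpa [h2] using h

theorem leftInvMetric_apply (x u v : 𝔫) :
    (leftInvMetric 𝔫).val x u v = inner ℝ (fderiv ℝ (leftTrans (exp x)⁻¹) x u)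
      (fderiv ℝ (leftTrans (exp x)⁻¹) x v) := by
  simp [leftInvMetric]

/-- The curve `γ_Z(t) = exp (t Z)` in `N`. -/
def gammaZ (Z : 𝔫) (t : ℝ) : NilGroup 𝔫 := exp (t • Z)

end NilGroup

/-! Write `A` for `j(Z)` extended by zero to the center. Since Z is central, every point `sZ` of the
geodesic is central. There the chart metric is the given inner product, `Γ(Z,u) = Γ(u,Z) = -½ A u`
and `R(u,Z)Z = -¼ A² u`. The covariant derivative along the geodesic is therefore `Y' - ½ A Y`. In
the Jacobi equation the `A²` terms cancel, which leaves the constant coefficient equation `Y'' = A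
Y'`.

A solution with `Y(0) = 0` is determined by `v = Y'(0)`, because skewness of `A` makes `|Y'|`
constant. The velocities v whose solution vanishes at t form an `A`-invariant subspace W. The
operator `A²` is symmetric, so W is the sum of its intersections with the eigenspaces of `A²`, whose
eigenvalues are `-θ² ≤ 0`. For `θ = 0` the solution is `s v`, which does not return to zero. For `θ
> 0` it is a combination of `sin(θs) v` and `(1 - cos(θs)) A v`, where v and `A v` are orthogonal,
and it vanishes at t exactly when `cos(θt) = 1`. Thus W is the direct sum of `ker(A² + θ²)` over `θ
> 0` in `(2π/t)ℤ`. Each summand is real-isomorphic to the complex eigenspace for `iθ`, which is the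
source of the factor 2. -/

/-! ### Real and complex eigenspaces -/

section Complexification

variable {V : Type*} [AddCommGroup V] [Module ℝ V]

/-- The real part `ℂ ⊗ V → V`. -/
noncomputable def tensorRe (V : Type*) [AddCommGroup V] [Module ℝ V] : ℂ ⊗[ℝ] V →ₗ[ℝ] V :=
  (TensorProduct.lid ℝ V).toLinearMap ∘ₗ Complex.reLm.rTensor V

/-- The imaginary part `ℂ ⊗ V → V`. -/
noncomputable def tensorIm (V : Type*) [AddCommGroup V] [Module ℝ V] : ℂ ⊗[ℝ] V →ₗ[ℝ] V :=
  (TensorProduct.lid ℝ V).toLinearMap ∘ₗ Complex.imLm.rTensor V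

@[simp] theorem tensorRe_tmul (z : ℂ) (v : V) : tensorRe V (z ⊗ₜ v) = z.re • v := by
  simp [tensorRe]

@[simp] theorem tensorIm_tmul (z : ℂ) (v : V) : tensorIm V (z ⊗ₜ v) = z.im • v := by
  simp [tensorIm]

theorem tensor_re_add_im (x : ℂ ⊗[ℝ] V) :
    (1 : ℂ) ⊗ₜ[ℝ] tensorRe V x + Complex.I ⊗ₜ[ℝ] tensorIm V x = x := by
  induction x with
  | zero => simp
  | add x y hx hy =>
    conv_rhs => rw [← hx, ← hy]
    simp only [map_add, TensorProduct.tmul_add]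
    abel
  | tmul z v =>
    rw [tensorRe_tmul, tensorIm_tmul, ← TensorProduct.smul_tmul, ← TensorProduct.smul_tmul,
      ← TensorProduct.add_tmul]
    congr 1
    apply Complex.ext <;> simp

/-- For a real operator `B` and real `θ ≠ 0`, the space `ker (B² + θ²)` is isomorphic over the reals
to the eigenspace of the complexification of `B` for the eigenvalue `θ i`. -/
noncomputable def eigenspaceSqToComplex (B : V →ₗ[ℝ] V) (θ : ℝ) :
    Module.End.eigenspace (B * B : Module.End ℝ V) (-θ ^ 2) →ₗ[ℝ]
      Module.End.eigenspace (B.baseChange ℂ : Module.End ℂ (ℂ ⊗[ℝ] V)) (θ * Complex.I) where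
  -- The map is `v ↦ (B + iθ)v`. Its values lie in `ker (B - iθ)` because `(B - iθ)(B + iθ) = B² +
  -- θ²`.
  toFun v := ⟨(1 : ℂ) ⊗ₜ[ℝ] B v + (θ * Complex.I) ⊗ₜ[ℝ] (v : V), by
    have hv : B (B v) = (-θ ^ 2) • (v : V) := Module.End.mem_eigenspace_iff.1 v.2
    rw [Module.End.mem_eigenspace_iff, map_add, LinearMap.baseChange_tmul,
      LinearMap.baseChange_tmul, hv, smul_add, TensorProduct.smul_tmul', TensorProduct.smul_tmul',
      ← TensorProduct.smul_tmul, add_comm]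
    congr 2
    · simp
    · apply Complex.ext <;> simp [pow_two]⟩
  map_add' v w := by
    apply Subtype.ext
    simp only [Submodule.coe_add, map_add, TensorProduct.tmul_add]
    abel
  map_smul' r v := by
    apply Subtype.ext
    change (1 : ℂ) ⊗ₜ[ℝ] B (r • (v : V)) + (θ * Complex.I) ⊗ₜ[ℝ] (r • (v : V))
      = (r : ℂ) • ((1 : ℂ) ⊗ₜ[ℝ] B v + (θ * Complex.I) ⊗ₜ[ℝ] (v : V))
    rw [map_smul, smul_add, TensorProduct.smul_tmul', TensorProduct.smul_tmul',
      ← TensorProduct.smul_tmul, ← TensorProduct.smul_tmul]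
    simp

theorem eigenspaceSqToComplex_bijective (B : V →ₗ[ℝ] V) {θ : ℝ} (hθ : θ ≠ 0) :
    Function.Bijective (eigenspaceSqToComplex B θ) := by
  constructor
  · rw [injective_iff_map_eq_zero]
    intro v hv
    have h : (1 : ℂ) ⊗ₜ[ℝ] B v + (θ * Complex.I) ⊗ₜ[ℝ] (v : V) = 0 := congrArg Subtype.val hv
    -- The imaginary part of `(B + iθ)v` is `θ v`, which already determines v.
    have h2 := congrArg (tensorIm V) h
    simp only [map_add, tensorIm_tmul] at h2
    simpa [hθ] using h2
  · rintro ⟨x, hx⟩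
    rw [Module.End.mem_eigenspace_iff] at hx
    have hx' := hx
    rw [← tensor_re_add_im x] at hx'
    set a := tensorRe V x
    set b := tensorIm V x
    have h1 := congrArg (tensorRe V) hx'
    have h2 := congrArg (tensorIm V) hx'
    simp only [map_add, smul_add, LinearMap.baseChange_tmul, TensorProduct.smul_tmul',
      tensorRe_tmul, tensorIm_tmul] at h1 h2
    simp at h1 h2
    -- For `x = a + ib` the eigenvalue equation reads `B a = -θ b`, `B b = θ a`. Hence `v = θ⁻¹ b`
    -- has `B v = a` and `iθ v = ib`.
    refine ⟨⟨θ⁻¹ • b, ?_⟩, ?_⟩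
    · rw [Module.End.mem_eigenspace_iff, Module.End.mul_apply, map_smul, map_smul, h2, map_smul, h1]
      rw [smul_smul, inv_mul_cancel₀ hθ, one_smul, smul_smul]
      rw [← neg_smul]
      congr 1
      field_simp
    · apply Subtype.ext
      change (1 : ℂ) ⊗ₜ[ℝ] B (θ⁻¹ • b) + (θ * Complex.I) ⊗ₜ[ℝ] (θ⁻¹ • b) = x
      rw [map_smul, h2, smul_smul, inv_mul_cancel₀ hθ, one_smul, ← TensorProduct.smul_tmul]
      conv_rhs => rw [← tensor_re_add_im x]
      congr 2
      rw [Complex.real_smul, ← mul_assoc]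
      norm_cast
      rw [inv_mul_cancel₀ hθ]
      simp

theorem finrank_eigenspace_sq (B : V →ₗ[ℝ] V) {θ : ℝ} (hθ : θ ≠ 0) :
    Module.finrank ℝ (Module.End.eigenspace (B * B : Module.End ℝ V) (-θ ^ 2)) =
      2 * Module.finrank ℂ
        (Module.End.eigenspace (B.baseChange ℂ : Module.End ℂ (ℂ ⊗[ℝ] V)) (θ * Complex.I)) := by
  rw [← finrank_real_of_complex]
  exact (LinearEquiv.ofBijective _ (eigenspaceSqToComplex_bijective B hθ)).finrank_eq

end Complexification

theorem finrank_iSup_of_iSupIndep {K M ι : Type*} [Field K] [AddCommGroup M] [Module K M]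
    [FiniteDimensional K M] [Fintype ι] {p : ι → Submodule K M} (hp : iSupIndep p) :
    Module.finrank K (⨆ i, p i : Submodule K M) = ∑ i, Module.finrank K (p i) := by
  classical
  rw [Submodule.iSup_eq_range_dfinsupp_lsum,
    ← (LinearEquiv.ofInjective _ hp.dfinsupp_lsum_injective).finrank_eq]
  exact Module.finrank_directSum K fun i => p i

/-! ### The boundary value problem `Y'' = A Y'` for skew `A` -/

section SkewODE

variable {E : Type*} [NormedAddCommGroup E] [InnerProductSpace ℝ E]

/-- `Y` solves `Y'' = A Y'` with `Y(0) = Y(t) = 0` and `Y'(0) = v`. -/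
def IsSkewSolution (A : E →ₗ[ℝ] E) (t : ℝ) (v : E) (Y : ℝ → E) : Prop :=
  ∃ D : ℝ → E, (∀ s, HasDerivAt Y (D s) s) ∧ (∀ s, HasDerivAt D (A (D s)) s) ∧
    Y 0 = 0 ∧ Y t = 0 ∧ D 0 = v

variable {A : E →ₗ[ℝ] E} {t : ℝ} {v w : E} {Y X : ℝ → E}

theorem IsSkewSolution.add (hY : IsSkewSolution A t v Y) (hX : IsSkewSolution A t w X) :
    IsSkewSolution A t (v + w) (Y + X) := by
  obtain ⟨D, h1, h2, h3, h4, h5⟩ := hY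
  obtain ⟨F, k1, k2, k3, k4, k5⟩ := hX
  exact ⟨D + F, fun s => (h1 s).add (k1 s),
    fun s => ((h2 s).add (k2 s)).congr_deriv (by simp), by simp [h3, k3], by simp [h4, k4],
    by simp [h5, k5]⟩

theorem IsSkewSolution.smul (c : ℝ) (hY : IsSkewSolution A t v Y) :
    IsSkewSolution A t (c • v) (c • Y) := by
  obtain ⟨D, h1, h2, h3, h4, h5⟩ := hY
  exact ⟨c • D, fun s => (h1 s).const_smul c,
    fun s => ((h2 s).const_smul c).congr_deriv (by simp), by simp [h3], by simp [h4],
    by simp [h5]⟩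

/-- `A` is constant in time and commutes with the equation. This makes the space of admissible
initial velocities `A`-invariant. -/
theorem IsSkewSolution.map [FiniteDimensional ℝ E] (hY : IsSkewSolution A t v Y) :
    IsSkewSolution A t (A v) (fun s => A (Y s)) := by
  obtain ⟨D, h1, h2, h3, h4, h5⟩ := hY
  refine ⟨fun s => A (D s), fun s => ?_, fun s => ?_, by simp [h3], by simp [h4], by simp [h5]⟩
  · exact (LinearMap.toContinuousLinearMap A).hasFDerivAt.comp_hasDerivAt s (h1 s)
  · exact (LinearMap.toContinuousLinearMap A).hasFDerivAt.comp_hasDerivAt s (h2 s)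

theorem IsSkewSolution.deriv_zero (hY : IsSkewSolution A t v Y) : deriv Y 0 = v := by
  obtain ⟨D, h1, -, -, -, h5⟩ := hY
  rw [(h1 0).deriv, h5]

/-- Solutions of `Y'' = A Y'` with `Y(0) = 0` and `Y'(0) = 0` vanish when `A` is skew symmetric. -/
theorem eq_zero_of_skew_ode (hA : ∀ x y, inner ℝ (A x) y = -inner ℝ x (A y)) {Y D : ℝ → E}
    (h1 : ∀ s, HasDerivAt Y (D s) s) (h2 : ∀ s, HasDerivAt D (A (D s)) s) (hY : Y 0 = 0)
    (hD : D 0 = 0) (s : ℝ) : Y s = 0 := by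
  have hD' (s : ℝ) : D s = 0 := by
    -- The energy `⟨D, D⟩` is conserved, since skewness makes the two terms of its derivative
    -- cancel.
    have hd (s : ℝ) : HasDerivAt (fun s => (inner ℝ (D s) (D s) : ℝ)) 0 s := by
      refine ((h2 s).inner ℝ (h2 s)).congr_deriv ?_
      rw [hA]
      ring
    have := is_const_of_deriv_eq_zero (fun s => (hd s).differentiableAt)
      (fun s => (hd s).deriv) s 0
    simpa [hD] using this
  have := is_const_of_deriv_eq_zero (fun s => (h1 s).differentiableAt)
    (fun s => by rw [(h1 s).deriv, hD']) s 0
  rw [this, hY]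

theorem IsSkewSolution.eq_zero (hA : ∀ x y, inner ℝ (A x) y = -inner ℝ x (A y))
    (hY : IsSkewSolution A t 0 Y) : Y = 0 := by
  obtain ⟨D, h1, h2, h3, -, h5⟩ := hY
  exact funext (eq_zero_of_skew_ode hA h1 h2 h3 h5)

/-- The solutions of `Y'' = A Y'` with `Y(0) = Y(t) = 0`. -/
def skewSolutions (A : E →ₗ[ℝ] E) (t : ℝ) : Submodule ℝ (ℝ → E) where
  carrier := {Y | ∃ v, IsSkewSolution A t v Y}
  zero_mem' := ⟨0, 0, fun s => hasDerivAt_const s 0,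
    fun s => (hasDerivAt_const s (0 : E)).congr_deriv (by simp), rfl, rfl, rfl⟩
  add_mem' := fun ⟨v, hv⟩ ⟨w, hw⟩ => ⟨v + w, hv.add hw⟩
  smul_mem' := fun c _ ⟨v, hv⟩ => ⟨c • v, hv.smul c⟩

/-- The initial velocity of a solution. -/
noncomputable def initialVelocity (A : E →ₗ[ℝ] E) (t : ℝ) : skewSolutions A t →ₗ[ℝ] E where
  toFun Y := deriv (Y : ℝ → E) 0
  map_add' := by
    rintro ⟨Y, v, hv⟩ ⟨X, w, hw⟩
    change deriv (Y + X) 0 = deriv Y 0 + deriv X 0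
    rw [hv.deriv_zero, hw.deriv_zero, (hv.add hw).deriv_zero]
  map_smul' := by
    rintro c ⟨Y, v, hv⟩
    change deriv (c • Y) 0 = c • deriv Y 0
    rw [hv.deriv_zero, (hv.smul c).deriv_zero]

/-- Uniqueness for the equation; it replaces the function space of solutions by a subspace of `E`.
-/
theorem initialVelocity_injective (hA : ∀ x y, inner ℝ (A x) y = -inner ℝ x (A y)) :
    Function.Injective (initialVelocity A t) := by
  rw [injective_iff_map_eq_zero]
  rintro ⟨Y, v, hv⟩ h
  have h' : deriv Y 0 = 0 := h
  rw [hv.deriv_zero] at h'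
  subst h'
  exact Subtype.ext (hv.eq_zero hA)

theorem mem_range_initialVelocity :
    v ∈ LinearMap.range (initialVelocity A t) ↔ ∃ Y, IsSkewSolution A t v Y := by
  constructor
  · rintro ⟨⟨Y, w, hw⟩, h⟩
    have h' : deriv Y 0 = v := h
    rw [hw.deriv_zero] at h'
    exact ⟨Y, h' ▸ hw⟩
  · rintro ⟨Y, hY⟩
    exact ⟨⟨Y, v, hY⟩, hY.deriv_zero⟩

/-- The explicit solution of `Y'' = A Y'` with initial velocity in `ker (A² + θ²)`. -/
theorem hasDerivAt_explicit [FiniteDimensional ℝ E] {θ : ℝ} (hθ : θ ≠ 0)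
    (hv : A (A v) = (-θ ^ 2) • v) :
    (∀ s : ℝ, HasDerivAt
      (fun s => (Real.sin (θ * s) / θ) • v + ((1 - Real.cos (θ * s)) / θ ^ 2) • A v)
      (Real.cos (θ * s) • v + (Real.sin (θ * s) / θ) • A v) s) ∧
    ∀ s : ℝ, HasDerivAt (fun s => Real.cos (θ * s) • v + (Real.sin (θ * s) / θ) • A v)
      (A (Real.cos (θ * s) • v + (Real.sin (θ * s) / θ) • A v)) s := by
  have hm (s : ℝ) : HasDerivAt (fun s : ℝ => θ * s) θ s := by
    simpa using (hasDerivAt_id s).const_mul θ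
  constructor
  · intro s
    refine ((((hm s).sin.div_const θ).smul_const v).add
      ((((hm s).cos.const_sub 1).div_const (θ ^ 2)).smul_const (A v))).congr_deriv ?_
    congr 2 <;> field_simp
  · intro s
    refine (((hm s).cos.smul_const v).add
      (((hm s).sin.div_const θ).smul_const (A v))).congr_deriv ?_
    rw [map_add, map_smul, map_smul, hv, smul_smul, add_comm]
    congr 2 <;> field_simp

/-- Initial velocities in `ker (A² + θ²)`. -/
theorem exists_isSkewSolution_iff [FiniteDimensional ℝ E]
    (hA : ∀ x y, inner ℝ (A x) y = -inner ℝ x (A y)) {θ : ℝ} (hθ : θ ≠ 0)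
    (hv : A (A v) = (-θ ^ 2) • v) (hv0 : v ≠ 0) :
    (∃ Y, IsSkewSolution A t v Y) ↔ Real.cos (θ * t) = 1 := by
  obtain ⟨e1, e2⟩ := hasDerivAt_explicit hθ hv
  constructor
  · rintro ⟨Y, D, h1, h2, h3, h4, h5⟩
    -- By uniqueness Y is the explicit solution, so the latter vanishes at t.
    have key := eq_zero_of_skew_ode hA (fun s => (h1 s).sub (e1 s))
      (fun s => ((h2 s).sub (e2 s)).congr_deriv (map_sub A _ _).symm)
      (by simp [h3]) (by simp [h5]) t
    simp only [Pi.sub_apply, h4, zero_sub, neg_eq_zero] at key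
    have hAv : (inner ℝ v (A v) : ℝ) = 0 := by
      have := hA v v
      rw [real_inner_comm] at this
      linarith
    have hAA : (inner ℝ (A v) (A v) : ℝ) = θ ^ 2 * inner ℝ v v := by
      rw [hA, hv, inner_smul_right]
      ring
    -- Pairing with `A v` kills the `v` term and isolates `(1 - cos(θt))⟨v, v⟩`, because `|A v|² =
    -- θ²|v|²`.
    have h := congrArg (fun x => (inner ℝ (A v) x : ℝ)) key
    simp only [inner_add_right, inner_smul_right, inner_zero_right, hAA, real_inner_comm v (A v),
      hAv, mul_zero, zero_add] at h
    have hvv : (inner ℝ v v : ℝ) ≠ 0 := inner_self_ne_zero.2 hv0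
    have : (1 - Real.cos (θ * t)) * (inner ℝ v v : ℝ) = 0 := by
      rw [← h]
      field_simp
    rcases mul_eq_zero.1 this with h | h
    · linarith
    · exact absurd h hvv
  · intro hc
    have hs : Real.sin (θ * t) = 0 := Real.sin_eq_zero_iff_cos_eq.2 (Or.inl hc)
    exact ⟨_, _, e1, e2, by simp, by simp [hc, hs], by simp⟩

/-- With `A v = 0` the solution is the straight line `s v`, which is nonzero at t. -/
theorem not_isSkewSolution_of_ker (hA : ∀ x y, inner ℝ (A x) y = -inner ℝ x (A y)) (ht : t ≠ 0)
    (hv : A v = 0) (hv0 : v ≠ 0) : ¬ IsSkewSolution A t v Y := by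
  rintro ⟨D, h1, h2, h3, h4, h5⟩
  have e1 (s : ℝ) : HasDerivAt (fun s : ℝ => s • v) v s := by
    simpa using (hasDerivAt_id s).smul_const v
  have key := eq_zero_of_skew_ode hA (fun s => (h1 s).sub (e1 s))
    (fun s => ((h2 s).sub (hasDerivAt_const s v)).congr_deriv
      (by rw [← hv]; exact (map_sub A _ _).symm))
    (by simp [h3]) (by simp [h5]) t
  simp [h4, ht, hv0] at key

/-- Two sign changes cancel. Passing to `A²` gives real diagonalizability, which a skew `A` lacks
unless it is zero. -/
theorem isSymmetric_sq_of_skew (hA : ∀ x y, inner ℝ (A x) y = -inner ℝ x (A y)) :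
    (A * A : Module.End ℝ E).IsSymmetric := by
  intro x y
  simp only [Module.End.mul_apply, hA, neg_neg]

variable [FiniteDimensional ℝ E]

/-- The space of solutions of `Y'' = A Y'` with `Y(0) = Y(t) = 0` has the dimension of the sum of the
spaces `ker (A² + θ²)` over the `θ > 0` with `θ t ∈ 2πℤ`. -/
theorem finrank_skewSolutions (hA : ∀ x y, inner ℝ (A x) y = -inner ℝ x (A y)) (ht : t ≠ 0)
    (F : Finset ℝ) (hF : ∀ θ ∈ F, 0 < θ ∧ Real.cos (θ * t) = 1)
    (hF' : ∀ θ, 0 < θ → Real.cos (θ * t) = 1 →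
      Module.End.HasEigenvalue (A * A : Module.End ℝ E) (-θ ^ 2) → θ ∈ F) :
    Module.finrank ℝ (skewSolutions A t) =
      ∑ θ ∈ F, Module.finrank ℝ (Module.End.eigenspace (A * A : Module.End ℝ E) (-θ ^ 2)) := by
  set S : Module.End ℝ E := A * A
  set W := LinearMap.range (initialVelocity A t)
  have hS := isSymmetric_sq_of_skew hA
  have htop : ⨆ μ, S.eigenspace μ = ⊤ :=
    Submodule.orthogonal_eq_bot_iff.mp hS.orthogonalComplement_iSup_eigenspaces_eq_bot
  have hinv : ∀ x ∈ W, S x ∈ W := by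
    intro x hx
    obtain ⟨Y, hY⟩ := mem_range_initialVelocity.1 hx
    exact mem_range_initialVelocity.2 ⟨_, hY.map.map⟩
  -- A subspace invariant under a diagonalizable operator is spanned by the eigenvectors it
  -- contains.
  have hW : W = ⨆ μ, W ⊓ S.eigenspace μ :=
    Submodule.eq_iSup_inf_genEigenspace (k := 1) hinv htop
  have hW' : W = ⨆ θ : F, S.eigenspace (-(θ : ℝ) ^ 2) := by
    apply le_antisymm
    · rw [hW]
      refine iSup_le fun μ v hv => ?_
      by_cases hv0 : v = 0
      · rw [hv0]
        exact zero_mem _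
      obtain ⟨Y, hY⟩ := mem_range_initialVelocity.1 hv.1
      have hvμ : A (A v) = μ • v := Module.End.mem_eigenspace_iff.1 hv.2
      have hvv : 0 < (inner ℝ v v : ℝ) := real_inner_self_pos.2 hv0
      have hAA : (inner ℝ (A v) (A v) : ℝ) = -μ * inner ℝ v v := by
        rw [hA, hvμ, inner_smul_right]
        ring
      -- Eigenvalues of `A²` are nonpositive since `|A v|² = -μ |v|²`, so `θ = √(-μ)` is available;
      -- `μ = 0` forces `A v = 0`.
      have hμ : 0 ≤ -μ := by
        have : 0 ≤ (inner ℝ (A v) (A v) : ℝ) := real_inner_self_nonneg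
        rw [hAA] at this
        exact nonneg_of_mul_nonneg_left this hvv
      rcases hμ.eq_or_lt with h0 | hpos
      · rw [← h0, zero_mul, inner_self_eq_zero] at hAA
        exact absurd hY (not_isSkewSolution_of_ker hA ht hAA hv0)
      · have hθ : 0 < √(-μ) := Real.sqrt_pos.2 hpos
        have hsq : -(√(-μ)) ^ 2 = μ := by rw [Real.sq_sqrt hμ, neg_neg]
        have hmem : √(-μ) ∈ F := by
          refine hF' _ hθ ((exists_isSkewSolution_iff hA hθ.ne' (by rw [hsq, hvμ]) hv0).1
            ⟨Y, hY⟩) ?_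
          rw [hsq]
          exact Module.End.hasEigenvalue_of_hasEigenvector ⟨hv.2, hv0⟩
        refine Submodule.mem_iSup_of_mem ⟨√(-μ), hmem⟩ ?_
        rw [hsq]
        exact hv.2
    -- The condition `cos(θt) = 1` does not involve v, so W contains the whole eigenspace.
    · refine iSup_le fun θ v hv => ?_
      by_cases hv0 : v = 0
      · rw [hv0]
        exact zero_mem _
      obtain ⟨hθ, hc⟩ := hF θ θ.2
      exact mem_range_initialVelocity.2
        ((exists_isSkewSolution_iff hA hθ.ne' (Module.End.mem_eigenspace_iff.1 hv) hv0).2 hc)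
  have hind : iSupIndep fun θ : F => S.eigenspace (-(θ : ℝ) ^ 2) := by
    refine S.eigenspaces_iSupIndep.comp (f := fun θ : F => -(θ : ℝ) ^ 2) ?_
    intro a b hab
    have := (hF a a.2).1
    have := (hF b b.2).1
    apply Subtype.ext
    rw [← sq_eq_sq₀ (by positivity) (by positivity)]
    simpa using hab
  rw [(LinearEquiv.ofInjective _ (initialVelocity_injective hA)).finrank_eq]
  change Module.finrank ℝ W = _
  rw [hW', finrank_iSup_of_iSupIndep hind]
  exact Finset.sum_coe_sort F fun θ => Module.finrank ℝ (S.eigenspace (-θ ^ 2))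

/-- Needed because `finrank` is 0 on infinite-dimensional spaces, so it detects nontriviality only
under finiteness. -/
theorem finiteDimensional_skewSolutions (hA : ∀ x y, inner ℝ (A x) y = -inner ℝ x (A y)) :
    FiniteDimensional ℝ (skewSolutions A t) :=
  FiniteDimensional.of_injective _ (initialVelocity_injective hA)

end SkewODE


/-! ### Extending `j(Z)` to the whole algebra, and the set `c(Z,t)` -/

section SkewExtension

variable {𝔫 : Type*} [MetricLieAlgebra 𝔫]

theorem lie_eq_zero_of_mem_center {X : 𝔫} (hX : X ∈ LieAlgebra.center ℝ 𝔫) (Y : 𝔫) :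
    ⁅X, Y⁆ = 0 ∧ ⁅Y, X⁆ = 0 := by
  have h : ⁅Y, X⁆ = 0 := (LieModule.mem_maxTrivSubmodule ℝ 𝔫 𝔫 X).1 hX Y
  exact ⟨by rw [← lie_skew, h, neg_zero], h⟩

variable [FiniteDimensional ℝ 𝔫]

/-- The extension of `j(Z)` to `𝔫` by zero on the center. -/
noncomputable def jExt (Z : 𝔫) : 𝔫 →ₗ[ℝ] 𝔫 :=
  (vSpace 𝔫).subtype ∘ₗ jMap Z ∘ₗ (vSpace 𝔫).orthogonalProjectionOnto.toLinearMap

theorem jExt_coe (Z : 𝔫) (X : vSpace 𝔫) : jExt Z (X : 𝔫) = jMap Z X := by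
  simp [jExt]

theorem jExt_mem (Z X : 𝔫) : jExt Z X ∈ vSpace 𝔫 := by
  simp [jExt]

theorem sub_orthogonalProjectionOnto_mem_center (X : 𝔫) :
    X - (vSpace 𝔫).orthogonalProjectionOnto X ∈ LieAlgebra.center ℝ 𝔫 := by
  have h := Submodule.sub_starProjection_mem_orthogonal (K := vSpace 𝔫) X
  rwa [vSpace, Submodule.orthogonal_orthogonal] at h

/-- Central components drop out of the bracket, so the defining identity of `j(Z)` persists on all
of `𝔫`. -/
theorem inner_jExt (Z X Y : 𝔫) : (inner ℝ (jExt Z X) Y : ℝ) = inner ℝ ⁅X, Y⁆ Z := by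
  set P := (vSpace 𝔫).orthogonalProjectionOnto
  have h1 : (inner ℝ (jExt Z X) Y : ℝ) = inner ℝ (jMap Z (P X)) (P Y) := by
    simp [jExt, P]
  have h2 : ⁅X, Y⁆ = ⁅(P X : 𝔫), (P Y : 𝔫)⁆ := by
    have hX := (lie_eq_zero_of_mem_center (sub_orthogonalProjectionOnto_mem_center X) Y).1
    have hY := (lie_eq_zero_of_mem_center (sub_orthogonalProjectionOnto_mem_center Y) (P X : 𝔫)).2
    rw [sub_lie, sub_eq_zero] at hX
    rw [lie_sub, sub_eq_zero] at hY
    rw [hX, hY]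
  rw [h1, inner_jMap, h2]

theorem inner_jExt_skew (Z X Y : 𝔫) : (inner ℝ (jExt Z X) Y : ℝ) = -inner ℝ X (jExt Z Y) := by
  rw [inner_jExt, real_inner_comm, real_inner_comm _ X, inner_jExt, ← lie_skew, inner_neg_right,
    real_inner_comm]

/-- For `c ≠ 0` an eigenvector is `c⁻¹` times its image, hence lies in `𝔙`; the center contributes
only to the eigenvalue 0. -/
theorem eigenspace_jExt_sq (Z : 𝔫) {c : ℝ} (hc : c ≠ 0) :
    Module.End.eigenspace (jExt Z * jExt Z : Module.End ℝ 𝔫) c =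
      (Module.End.eigenspace (jMap Z * jMap Z : Module.End ℝ (vSpace 𝔫)) c).map
        (vSpace 𝔫).subtype := by
  ext x
  rw [Module.End.mem_eigenspace_iff, Module.End.mul_apply, Submodule.mem_map]
  constructor
  · intro h
    have hx : x ∈ vSpace 𝔫 := by
      have : x = c⁻¹ • jExt Z (jExt Z x) := by rw [h, smul_smul, inv_mul_cancel₀ hc, one_smul]
      rw [this]
      exact Submodule.smul_mem _ _ (jExt_mem _ _)
    refine ⟨⟨x, hx⟩, ?_, rfl⟩
    rw [Module.End.mem_eigenspace_iff, Module.End.mul_apply]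
    apply Subtype.ext
    rw [← jExt_coe, ← jExt_coe]
    exact h
  · rintro ⟨y, hy, rfl⟩
    rw [Module.End.mem_eigenspace_iff, Module.End.mul_apply] at hy
    simp only [Submodule.subtype_apply]
    rw [jExt_coe, jExt_coe, hy]
    rfl

theorem finrank_eigenspace_jExt_sq (Z : 𝔫) {θ : ℝ} (hθ : θ ≠ 0) :
    Module.finrank ℝ (Module.End.eigenspace (jExt Z * jExt Z : Module.End ℝ 𝔫) (-θ ^ 2)) =
      2 * eigenMultiplicity Z (θ * Complex.I) := by
  rw [eigenspace_jExt_sq Z (by simpa using hθ), Submodule.finrank_map_subtype_eq]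
  exact finrank_eigenspace_sq (jMap Z) hθ

theorem hasEigenvalue_iff_eigenMultiplicity_pos (Z : 𝔫) (μ : ℂ) :
    Module.End.HasEigenvalue (jMapC Z) μ ↔ 0 < eigenMultiplicity Z μ := by
  rw [eigenMultiplicity, Module.finrank_pos_iff, Submodule.nontrivial_iff_ne_bot]
  rfl

theorem cSet_finite (Z : 𝔫) (t : ℝ) : (cSet Z t).Finite :=
  (Module.End.finite_hasEigenvalue (jMapC Z)).subset fun _ h => h.2

theorem mem_cSet_iff (Z : 𝔫) {t : ℝ} (ht : 0 < t) (μ : ℂ) :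
    μ ∈ cSet Z t ↔ ∃ θ : ℝ, μ = θ * Complex.I ∧ 0 < θ ∧ Real.cos (θ * t) = 1 ∧
      0 < eigenMultiplicity Z μ := by
  rw [← hasEigenvalue_iff_eigenMultiplicity_pos]
  constructor
  · rintro ⟨⟨k, hk, rfl⟩, h⟩
    refine ⟨2 * Real.pi / t * k, ?_, by positivity, ?_, h⟩
    · push_cast
      ring
    · rw [← Real.cos_nat_mul_two_pi k]
      congr 1
      field_simp
  · rintro ⟨θ, rfl, hθ, hc, h⟩
    obtain ⟨n, hn⟩ := (Real.cos_eq_one_iff _).1 hc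
    -- The cosine condition yields only an integer multiple of `2π`; positivity of `θt` selects
    -- `ℤ⁺`.
    have hn0 : 0 < n := by
      have h1 : 0 < (n : ℝ) * (2 * Real.pi) := hn ▸ mul_pos hθ ht
      exact_mod_cast pos_of_mul_pos_left h1 (by positivity)
    obtain ⟨k, rfl⟩ := Int.eq_ofNat_of_zero_le hn0.le
    refine ⟨⟨k, by exact_mod_cast hn0, ?_⟩, h⟩
    have : θ = 2 * Real.pi / t * k := by
      field_simp
      rw [← hn]
      push_cast
      ring
    rw [this]
    push_cast
    ring

theorem finrank_skewSolutions_jExt (Z : 𝔫) {t : ℝ} (ht : 0 < t) :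
    Module.finrank ℝ (skewSolutions (jExt Z) t) =
      2 * ∑ μ ∈ (cSet_finite Z t).toFinset, eigenMultiplicity Z μ := by
  classical
  have him : ∀ μ ∈ (cSet_finite Z t).toFinset, ∃ θ : ℝ, μ = θ * Complex.I ∧ 0 < θ ∧
      Real.cos (θ * t) = 1 ∧ 0 < eigenMultiplicity Z μ := fun μ hμ =>
    (mem_cSet_iff Z ht μ).1 ((cSet_finite Z t).mem_toFinset.1 hμ)
  -- The frequencies θ are the imaginary parts of the elements `iθ` of `c(Z,t)`.
  rw [finrank_skewSolutions (inner_jExt_skew Z) ht.ne'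
    ((cSet_finite Z t).toFinset.image Complex.im), Finset.sum_image, Finset.mul_sum]
  · refine Finset.sum_congr rfl fun μ hμ => ?_
    obtain ⟨θ, rfl, hθ, -⟩ := him μ hμ
    have : ((θ : ℂ) * Complex.I).im = θ := by simp
    rw [this, finrank_eigenspace_jExt_sq Z hθ.ne']
  · intro μ hμ ν hν h
    obtain ⟨θ, rfl, -⟩ := him μ hμ
    obtain ⟨η, rfl, -⟩ := him ν hν
    simpa using h
  · intro θ hθ
    obtain ⟨μ, hμ, rfl⟩ := Finset.mem_image.1 hθ
    obtain ⟨θ, rfl, h1, h2, -⟩ := him μ hμ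
    simpa using And.intro h1 h2
  · intro θ hθ hc he
    refine Finset.mem_image.2 ⟨θ * Complex.I, ?_, by simp⟩
    rw [Set.Finite.mem_toFinset, mem_cSet_iff Z ht]
    refine ⟨θ, rfl, hθ, hc, ?_⟩
    have h := (Module.finrank_pos_iff (R := ℝ)).2 ((Submodule.nontrivial_iff_ne_bot).2 he)
    rw [finrank_eigenspace_jExt_sq Z hθ.ne'] at h
    omega

end SkewExtension

/-! ### Levi-Civita connection and curvature along `γ_Z` -/

namespace NilGroup

variable {𝔫 : Type*} [MetricLieAlgebra 𝔫] [IsTwoStepNilpotent 𝔫]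

theorem mem_center_of_mem_lie {Z : 𝔫}
    (hZ : Z ∈ ⁅(⊤ : LieIdeal ℝ 𝔫), (⊤ : LieIdeal ℝ 𝔫)⁆) :
    Z ∈ LieAlgebra.center ℝ 𝔫 := by
  have h : ⁅(⊤ : LieIdeal ℝ 𝔫), (⊤ : LieIdeal ℝ 𝔫)⁆ ≤ LieAlgebra.center ℝ 𝔫 := by
    rw [LieSubmodule.lie_le_iff]
    intro X _ Y _
    exact (LieModule.mem_maxTrivSubmodule ℝ 𝔫 𝔫 _).2 fun W => lie_lie_right W X Y
  exact h hZ

variable [FiniteDimensional ℝ 𝔫]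

theorem leftInvMetric_val (x u v : 𝔫) :
    (leftInvMetric 𝔫).val x u v =
      inner ℝ (u - (1 / 2 : ℝ) • ⁅x, u⁆) (v - (1 / 2 : ℝ) • ⁅x, v⁆) := by
  rw [leftInvMetric_apply, fderiv_leftTrans_apply, fderiv_leftTrans_apply, log_inv, log_exp]
  simp only [neg_lie, smul_neg, ← sub_eq_add_neg]

theorem fderiv_leftInvMetric (x h u v : 𝔫) :
    fderiv ℝ (leftInvMetric 𝔫).val x h u v =
      -(1 / 2) * (inner ℝ ⁅h, u⁆ (v - (1 / 2 : ℝ) • ⁅x, v⁆)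
        + inner ℝ (u - (1 / 2 : ℝ) • ⁅x, u⁆) ⁅h, v⁆) := by
  have hd : HasFDerivAt (leftInvMetric 𝔫).val (fderiv ℝ (leftInvMetric 𝔫).val x) x :=
    ((leftInvMetric 𝔫).smooth.differentiable (by simp) x).hasFDerivAt
  have h1 := ((hd.clm_apply (hasFDerivAt_const u x)).clm_apply (hasFDerivAt_const v x))
  have hl (w : 𝔫) : HasFDerivAt (fun y : 𝔫 => w - (1 / 2 : ℝ) • ⁅y, w⁆)
      (-((1 / 2 : ℝ) • (bracketL 𝔫).flip w)) x := by
    have := (((bracketL 𝔫).flip w).hasFDerivAt (x := x)).const_smul (1 / 2 : ℝ)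
    simpa [bracketL_apply] using this.const_sub w
  have h2 := (hl u).inner ℝ (hl v)
  simp only [← leftInvMetric_val] at h2
  have := congrArg (fun L => L h) (h1.unique h2)
  simp [bracketL_apply, fderivInnerCLM_apply] at this
  rw [this]
  simp only [inner_smul_left, inner_smul_right, inner_sub_left,
    inner_sub_right]
  simp
  ring

/-- Nondegeneracy of the metric: a vector is determined by its pairings, so a Christoffel symbol can
be guessed and checked. -/
theorem christoffel_eq_of_val {x u v w : 𝔫}
    (h : ∀ y, (leftInvMetric 𝔫).val x w y = 1 / 2 * (fderiv ℝ (leftInvMetric 𝔫).val x u v y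
      + fderiv ℝ (leftInvMetric 𝔫).val x v u y - fderiv ℝ (leftInvMetric 𝔫).val x y u v)) :
    (leftInvMetric 𝔫).christoffel x u v = w := by
  obtain ⟨e, he⟩ := (leftInvMetric 𝔫).exists_equiv x
  apply e.injective
  have he' (y : 𝔫) : e y = (leftInvMetric 𝔫).val x y := by rw [← he]; rfl
  rw [he', he']
  ext y
  rw [CoordMetric.val_christoffel, h]

variable {Z : 𝔫}

/-- This holds at every x, not only at central points, because the curvature differentiates it in an
arbitrary direction u. It also shows that `s ↦ sZ` is a geodesic. -/
theorem christoffel_self_of_central (hZ : Z ∈ LieAlgebra.center ℝ 𝔫) (x : 𝔫) :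
    (leftInvMetric 𝔫).christoffel x Z Z = 0 := by
  refine christoffel_eq_of_val fun y => ?_
  simp [fderiv_leftInvMetric, lie_eq_zero_of_mem_center hZ]

/-- The derivative of the metric along Z vanishes. The other two Koszul terms each contribute
`-½⟨[u,y], Z⟩`. -/
theorem christoffel_left_of_central (hZ : Z ∈ LieAlgebra.center ℝ 𝔫) {x : 𝔫}
    (hx : x ∈ LieAlgebra.center ℝ 𝔫) (u : 𝔫) :
    (leftInvMetric 𝔫).christoffel x Z u = -(1 / 2 : ℝ) • jExt Z u := by
  refine christoffel_eq_of_val fun y => ?_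
  simp only [fderiv_leftInvMetric, leftInvMetric_val, lie_eq_zero_of_mem_center hZ,
    lie_eq_zero_of_mem_center hx, smul_zero, sub_zero, inner_zero_left, inner_zero_right,
    inner_smul_left, inner_jExt, ← lie_skew u y, inner_neg_right,
    real_inner_comm Z]
  simp
  ring

theorem christoffel_right_of_central (hZ : Z ∈ LieAlgebra.center ℝ 𝔫) {x : 𝔫}
    (hx : x ∈ LieAlgebra.center ℝ 𝔫) (u : 𝔫) :
    (leftInvMetric 𝔫).christoffel x u Z = -(1 / 2 : ℝ) • jExt Z u := by
  refine christoffel_eq_of_val fun y => ?_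
  simp only [fderiv_leftInvMetric, leftInvMetric_val, lie_eq_zero_of_mem_center hZ,
    lie_eq_zero_of_mem_center hx, smul_zero, sub_zero, inner_zero_left, inner_zero_right,
    inner_smul_left, inner_jExt, ← lie_skew u y, inner_neg_right,
    real_inner_comm Z]
  simp
  ring

theorem curvature_of_central (hZ : Z ∈ LieAlgebra.center ℝ 𝔫) {x : 𝔫}
    (hx : x ∈ LieAlgebra.center ℝ 𝔫) (u : 𝔫) :
    (leftInvMetric 𝔫).curvature x u Z Z = -(1 / 4 : ℝ) • jExt Z (jExt Z u) := by
  have h1 : fderiv ℝ (fun y => (leftInvMetric 𝔫).christoffel y Z Z) x = 0 := by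
    simp [christoffel_self_of_central hZ]
  -- Only the derivative along Z is required, and the line `x + rZ` stays in the center, where
  -- `Γ(u,Z)` is constant.
  have h2 : fderiv ℝ (fun y => (leftInvMetric 𝔫).christoffel y u Z) x Z = 0 := by
    have hd := (((leftInvMetric 𝔫).contDiff_christoffel u Z).differentiable
      (by simp) x).hasFDerivAt.hasLineDerivAt Z
    have hc : HasLineDerivAt ℝ (fun y => (leftInvMetric 𝔫).christoffel y u Z) 0 x Z := by
      rw [HasLineDerivAt]
      have (r : ℝ) : (leftInvMetric 𝔫).christoffel (x + r • Z) u Z = -(1 / 2 : ℝ) • jExt Z u :=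
        christoffel_right_of_central hZ (add_mem hx (SMulMemClass.smul_mem r hZ)) u
      simp only [this]
      exact hasDerivAt_const _ _
    exact hd.unique hc
  have h0 : (leftInvMetric 𝔫).christoffel x u 0 = 0 := by
    simpa using (leftInvMetric 𝔫).christoffel_smul_right x 0 u 0
  rw [CoordMetric.curvature, h1, h2, christoffel_self_of_central hZ, h0,
    christoffel_right_of_central hZ hx, christoffel_left_of_central hZ hx, map_smul, smul_smul]
  norm_num

theorem isJacobiField_gammaZ_iff (hZ : Z ∈ LieAlgebra.center ℝ 𝔫) (Y : ℝ → 𝔫) :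
    (leftInvMetric 𝔫).IsJacobiField (fun s => log (gammaZ Z s)) Y ↔
      ∃ D : ℝ → 𝔫, (∀ s, HasDerivAt Y (D s) s) ∧ ∀ s, HasDerivAt D (jExt Z (D s)) s := by
  have hγ (s : ℝ) : log (gammaZ Z s) = s • Z := rfl
  have hs (s : ℝ) : s • Z ∈ LieAlgebra.center ℝ 𝔫 := SMulMemClass.smul_mem s hZ
  have hγ' (s : ℝ) : deriv (fun s : ℝ => s • Z) s = Z := by
    have : HasDerivAt (fun s : ℝ => s • Z) Z s := by
      simpa using (hasDerivAt_id s).smul_const Z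
    exact this.deriv
  have hj {F : ℝ → 𝔫} {F' : 𝔫} {s : ℝ} (h : HasDerivAt F F' s) :
      HasDerivAt (fun s => jExt Z (F s)) (jExt Z F') s :=
    (LinearMap.toContinuousLinearMap (jExt Z)).hasFDerivAt.comp_hasDerivAt s h
  simp only [CoordMetric.IsJacobiField, CoordMetric.HasCovDerivAt, hγ', hγ,
    christoffel_left_of_central hZ (hs _), curvature_of_central hZ (hs _)]
  constructor
  · rintro ⟨J₁, J₂, h1, h2, h3⟩
    -- Here `D = Y'`, recovered from the covariant derivative `J₁ = Y' - ½ A Y`.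
    refine ⟨fun s => J₁ s - -(1 / 2 : ℝ) • jExt Z (Y s), h1, fun s => ?_⟩
    refine ((h2 s).sub ((hj (h1 s)).const_smul _)).congr_deriv ?_
    rw [eq_neg_of_add_eq_zero_left (h3 s)]
    simp only [map_sub, map_smul]
    module
  · rintro ⟨D, h1, h2⟩
    -- The second covariant derivative is dictated by the Jacobi equation: it must be `¼ A² Y`.
    refine ⟨fun s => D s + -(1 / 2 : ℝ) • jExt Z (Y s),
      fun s => (1 / 4 : ℝ) • jExt Z (jExt Z (Y s)), fun s => ?_, fun s => ?_, fun s => ?_⟩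
    · exact (h1 s).congr_deriv (by module)
    · refine ((h2 s).add ((hj (h1 s)).const_smul _)).congr_deriv ?_
      simp only [map_add, map_smul]
      module
    · module

theorem jacobiVanishing_gammaZ (hZ : Z ∈ LieAlgebra.center ℝ 𝔫) (t : ℝ) :
    (leftInvMetric 𝔫).jacobiVanishing (fun s => log (gammaZ Z s)) t =
      skewSolutions (jExt Z) t := by
  ext Y
  change (leftInvMetric 𝔫).IsJacobiField _ Y ∧ Y 0 = 0 ∧ Y t = 0 ↔
    ∃ v, IsSkewSolution (jExt Z) t v Y
  rw [isJacobiField_gammaZ_iff hZ]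
  constructor
  · rintro ⟨⟨D, h1, h2⟩, h3, h4⟩
    exact ⟨D 0, D, h1, h2, h3, h4, rfl⟩
  · rintro ⟨v, D, h1, h2, h3, h4, -⟩
    exact ⟨⟨D, h1, h2⟩, h3, h4⟩

end NilGroup

/-! ### Conjugate values and their multiplicities -/

theorem CoordMetric.isConjugateValue_iff_jacobiVanishing_ne_bot {E : Type*} [NormedAddCommGroup E]
    [NormedSpace ℝ E] [FiniteDimensional ℝ E] (g : CoordMetric E) (γ : ℝ → E) {t : ℝ}
    (ht : 0 < t) : g.IsConjugateValue γ t ↔ g.jacobiVanishing γ t ≠ ⊥ := by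
  rw [Submodule.ne_bot_iff]
  constructor
  · rintro ⟨-, J, h1, h2, h3, h4⟩
    exact ⟨J, ⟨h1, h3, h4⟩, h2⟩
  · rintro ⟨J, ⟨h1, h3, h4⟩, h2⟩
    exact ⟨ht, J, h1, h2, h3, h4⟩

theorem corollary4p5 {𝔫 : Type*} [MetricLieAlgebra 𝔫] [FiniteDimensional ℝ 𝔫]
    [IsTwoStepNilpotent 𝔫] (Z : 𝔫) (hZ : Z ∈ ⁅(⊤ : LieIdeal ℝ 𝔫), (⊤ : LieIdeal ℝ 𝔫)⁆)
    (hZ0 : Z ≠ 0) (t : ℝ) (ht : 0 < t) :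
    ((NilGroup.leftInvMetric 𝔫).IsConjugateValue (fun s => NilGroup.log (NilGroup.gammaZ Z s)) t
      ↔ (cSet Z t).Nonempty) ∧
    ∃ hfin : (cSet Z t).Finite,
      (NilGroup.leftInvMetric 𝔫).IsConjugateValue (fun s => NilGroup.log (NilGroup.gammaZ Z s)) t →
        (NilGroup.leftInvMetric 𝔫).conjugateMultiplicity
            (fun s => NilGroup.log (NilGroup.gammaZ Z s)) t
          = 2 * ∑ μ ∈ hfin.toFinset, eigenMultiplicity Z μ ∧
        Even ((NilGroup.leftInvMetric 𝔫).conjugateMultiplicity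
            (fun s => NilGroup.log (NilGroup.gammaZ Z s)) t) := by
  have hc := NilGroup.mem_center_of_mem_lie hZ
  have hm : (NilGroup.leftInvMetric 𝔫).conjugateMultiplicity
      (fun s => NilGroup.log (NilGroup.gammaZ Z s)) t
        = 2 * ∑ μ ∈ (cSet_finite Z t).toFinset, eigenMultiplicity Z μ := by
    rw [CoordMetric.conjugateMultiplicity, NilGroup.jacobiVanishing_gammaZ hc,
      finrank_skewSolutions_jExt Z ht]
  refine ⟨?_, cSet_finite Z t, fun _ => ⟨hm, hm ▸ even_two_mul _⟩⟩
  have := finiteDimensional_skewSolutions (t := t) (inner_jExt_skew Z)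
  -- The dimension formula holds for every `t > 0`, so being conjugate means that the sum is
  -- nonzero. Each member of `c(Z,t)` has positive multiplicity, so this means that `c(Z,t)` is
  -- nonempty.
  rw [CoordMetric.isConjugateValue_iff_jacobiVanishing_ne_bot _ _ ht,
    NilGroup.jacobiVanishing_gammaZ hc, ← Submodule.nontrivial_iff_ne_bot,
    ← Module.finrank_pos_iff (R := ℝ), finrank_skewSolutions_jExt Z ht,
    Nat.mul_pos_iff_of_pos_left two_pos, Nat.pos_iff_ne_zero, Ne, Finset.sum_eq_zero_iff]
  constructor
  · intro h
    by_contra he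
    rw [Set.not_nonempty_iff_eq_empty] at he
    exact h fun μ hμ => by simp [he] at hμ
  · rintro ⟨μ, hμ⟩ h
    exact ((hasEigenvalue_iff_eigenMultiplicity_pos Z μ).1 hμ.2).ne'
      (h μ ((cSet_finite Z t).mem_toFinset.2 hμ))
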